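/- Let $\mathcal M=\langle Q,\mathsf A,\delta\rangle$ be a Markov decision process with a finite set $Q$ of $n$ states, a finite nonempty set $\mathsf A$ of actions and transition function $\delta:Q\times\mathsf A\to\mathcal D(Q)$, let $d_0\in\mathcal D(Q)$ be an initial distribution, and let $T\subseteq Q$. For a (randomized, history-dependent) strategy $\sigma:(Q\mathsf A)^*Q\to\mathcal D(\mathsf A)$, let $\mathcal M^\sigma_i$ be the probability distribution over states after $i$ steps from $d_0$ under $\sigma$, and write $d(T)=\sum_{q\in T}d(q)$. An end-component is a set $S\subseteq Q$ such that (i) for every $q\in S$ the set $\mathsf A_S(q)=\{a\in\mathsf A:\mathrm{Supp}(\delta(q,a))\subseteq S\}$ is nonempty, and (ii) the graph on $S$ with an edge $(q,q')$ whenever $\delta(q,a)(q')>0$ for some $a\in\mathsf A_S(q)$ is strongly connected. Let $\mathcal E$ be the union of all end-components, and for $q\in\mathcal E$ let $\mathcal E(q)$ be the maximal end-component containing $q$. Let $\sigma_{\mathrm u}$ be the strategy that at every round plays all actions uniformly at random. The freezing strategy $\sigma_f$ plays like $\sigma_{\mathrm u}$ for the first $2^n$ rounds; afterwards, in a state $q\in\mathcal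 E$ it plays all actions of $\mathsf A_{\mathcal E(q)}(q)$ uniformly at random, and in a state $q\notin\mathcal E$ it plays all actions uniformly at random. For a strategy $\sigma$, say that $\sigma$ is - positively always synchronizing if $\mathcal M^\sigma_i(T)>0$ for all $i\ge 0$; - boundedly strongly synchronizing if there is $\epsilon>0$ such that $\mathcal M^\sigma_i(T)>\epsilon$ for all but finitely many $i$; - boundedly always synchronizing if there is $\epsilon>0$ such that $\mathcal M^\sigma_i(T)>\epsilon$ for all $i\ge 0$. Consider the conditions (1) $\mathcal M^{\sigma_{\mathrm u}}_i(T)>0$ for all $i\ge 0$; (2) $\mathcal M^{\sigma_{\mathrm u}}_i(\mathcal E\cap T)>0$ for all $i\ge 2^n$. Then: (a) there exists a positively always synchronizing strategy if and only if (1) holds; (b) there exists a boundedly strongly synchronizing strategy if and only if (2) holds; (c) there exists a boundedly always synchronizing strategy if and only if (1) and (2) hold. Moreover, if (2) holds then the freezing strategy $\sigma_f$ is boundedly strongly synchronizing, and if (1) and (2) hold then $\sigma_f$ is boundedly always synchronizing. -/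

import Mathlib

/-- A Markov decision process with state set `Q` and action set `A` (both finite wherever it is
used): `δ q a` is the probability distribution of the successor of `q` under the action `a`. -/
structure MDP (Q A : Type*) [Fintype Q] where
  δ : Q → A → stdSimplex ℝ Q

namespace MDP

section Distributions

/-- The support `{q | d q > 0}` of a distribution. -/
def supp {X : Type*} [Fintype X] (d : stdSimplex ℝ X) : Set X := {x | 0 < d x}

open Classical in
/-- The mass `d(T) = ∑_{x ∈ T} d(x)` of a set `T`. -/
noncomputable def mass {X : Type*} [Fintype X] (d : stdSimplex ℝ X) (T : Set X) : ℝ :=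
  ∑ x with x ∈ T, d x

open Classical in
/-- The uniform distribution on a nonempty set `s`. -/
noncomputable def uniformOn {X : Type*} [Fintype X] (s : Set X) (hs : s.Nonempty) :
    stdSimplex ℝ X :=
  ⟨fun x => if x ∈ s then (s.ncard : ℝ)⁻¹ else 0, by
    refine ⟨fun x => by dsimp only; split_ifs <;> positivity, ?_⟩
    have h0 : (s.ncard : ℝ) ≠ 0 := by
      exact_mod_cast ((Set.ncard_pos s.toFinite).2 hs).ne'
    rw [← Finset.sum_filter, Finset.sum_const, nsmul_eq_mul, Set.ncard_eq_toFinset_card' s,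
      show s.toFinset = Finset.univ.filter (· ∈ s) by ext; simp] at *
    exact mul_inv_cancel₀ h0⟩

end Distributions

section Runs

variable {Q A : Type*} [Fintype Q] [Fintype A]

/-- A randomized strategy. A history `q₀ a₀ q₁ a₁ … q_k` in `(QA)^*Q` is given by its length `k`,
its states `q : Fin (k + 1) → Q` and its actions `a : Fin k → A`. -/
abbrev Strategy (Q A : Type*) [Fintype A] : Type _ :=
  (k : ℕ) → (Fin (k + 1) → Q) → (Fin k → A) → stdSimplex ℝ A

/-- The probability of the finite sequence `q₀ a₀ q₁ … q_k`:
`d₀(q₀) · ∏_{j<k} σ(q₀ a₀ … q_j)(a_j) · δ(q_j, a_j)(q_{j+1})`. -/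
noncomputable def pathProb (M : MDP Q A) (d₀ : stdSimplex ℝ Q) (σ : Strategy Q A) {k : ℕ}
    (q : Fin (k + 1) → Q) (a : Fin k → A) : ℝ :=
  d₀ (q 0) * ∏ j : Fin k,
    σ j (fun m => q (m.castLE (by omega))) (fun m => a (m.castLE (by omega))) (a j) *
      M.δ (q j.castSucc) (a j) (q j.succ)

open Classical in
/-- The probability of being in state `s` after exactly `i` steps: the sum of the probabilities of
the (pairwise disjoint) cylinders of all sequences `q₀ a₀ q₁ … q_i` with `q_i = s`. -/
noncomputable def stepProb (M : MDP Q A) (d₀ : stdSimplex ℝ Q) (σ : Strategy Q A) (i : ℕ)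
    (s : Q) : ℝ :=
  ∑ q : Fin (i + 1) → Q with q (Fin.last i) = s, ∑ a : Fin i → A, M.pathProb d₀ σ q a

theorem pathProb_nonneg (M : MDP Q A) (d₀ : stdSimplex ℝ Q) (σ : Strategy Q A) {k : ℕ}
    (q : Fin (k + 1) → Q) (a : Fin k → A) : 0 ≤ M.pathProb d₀ σ q a :=
  mul_nonneg (d₀.2.1 _) (Finset.prod_nonneg fun _ _ => mul_nonneg ((σ _ _ _).2.1 _)
    ((M.δ _ _).2.1 _))

theorem pathProb_snoc (M : MDP Q A) (d₀ : stdSimplex ℝ Q) (σ : Strategy Q A) {k : ℕ}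
    (q : Fin (k + 1) → Q) (a : Fin k → A) (s : Q) (b : A) :
    M.pathProb d₀ σ (Fin.snoc q s : Fin (k + 1 + 1) → Q) (Fin.snoc a b : Fin (k + 1) → A) =
      M.pathProb d₀ σ q a * (σ k q a b * M.δ (q (Fin.last k)) b s) := by
  have hq : ∀ (i : ℕ) (h : i < k + 1 + 1) (h' : i < k + 1),
      (Fin.snoc q s : Fin (k + 1 + 1) → Q) ⟨i, h⟩ = q ⟨i, h'⟩ := fun i h h' =>
    Fin.snoc_castSucc (α := fun _ => Q) s q ⟨i, h'⟩
  have ha : ∀ (i : ℕ) (h : i < k + 1) (h' : i < k),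
      (Fin.snoc a b : Fin (k + 1) → A) ⟨i, h⟩ = a ⟨i, h'⟩ := fun i h h' =>
    Fin.snoc_castSucc (α := fun _ => A) b a ⟨i, h'⟩
  unfold pathProb
  rw [Fin.prod_univ_castSucc, ← mul_assoc]
  congr 1
  · congr 1
    · refine Finset.prod_congr rfl fun j _ => ?_
      have hj := j.2
      congr 1
      · have e1 : (fun m : Fin (j + 1) => (Fin.snoc q s : Fin (k + 1 + 1) → Q)
            (m.castLE (by omega))) = fun m : Fin (j + 1) => q (m.castLE (by omega)) :=
          funext fun m => hq m _ (by omega)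
        have e2 : (fun m : Fin j => (Fin.snoc a b : Fin (k + 1) → A) (m.castLE (by omega))) =
            fun m : Fin j => a (m.castLE (by omega)) :=
          funext fun m => ha m _ (by omega)
        have e3 := ha j (by omega) hj
        exact congr (congrArg (fun d : stdSimplex ℝ A => (d : A → ℝ))
          (congr (congrArg (σ j) e1) e2)) e3
      · have e1 := hq j (by omega) (by omega)
        have e2 := ha j (by omega) hj
        have e3 := hq (j + 1) (by omega) (by omega)
        exact congr (congrArg (fun d : stdSimplex ℝ Q => (d : Q → ℝ))
          (congr (congrArg M.δ e1) e2)) e3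
  · congr 1
    · have e1 : (fun m : Fin (k + 1) => (Fin.snoc q s : Fin (k + 1 + 1) → Q)
            (m.castLE (by omega))) = q :=
        funext fun m => hq m _ (by omega)
      have e2 : (fun m : Fin k => (Fin.snoc a b : Fin (k + 1) → A) (m.castLE (by omega))) = a :=
        funext fun m => ha m _ (by omega)
      have e3 : (Fin.snoc a b : Fin (k + 1) → A) (Fin.last k) = b := by simp
      exact congr (congrArg (fun d : stdSimplex ℝ A => (d : A → ℝ))
        (congr (congrArg (σ k) e1) e2)) e3
    · simp

theorem sum_pathProb (M : MDP Q A) (d₀ : stdSimplex ℝ Q) (σ : Strategy Q A) (k : ℕ) :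
    ∑ q : Fin (k + 1) → Q, ∑ a : Fin k → A, M.pathProb d₀ σ q a = 1 := by
  induction k with
  | zero =>
    rw [← (Equiv.funUnique (Fin 1) Q).symm.sum_comp]
    simp [pathProb]
  | succ k ih =>
    rw [← ih, ← (Fin.snocEquiv fun _ : Fin (k + 1 + 1) => Q).sum_comp, Fintype.sum_prod_type_right]
    refine Finset.sum_congr rfl fun q _ => ?_
    have h : ∀ s : Q, ∑ a : Fin (k + 1) → A,
        M.pathProb d₀ σ (Fin.snocEquiv (fun _ : Fin (k + 1 + 1) => Q) (s, q)) a =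
        ∑ a : Fin k → A, ∑ b : A,
          M.pathProb d₀ σ q a * (σ k q a b * M.δ (q (Fin.last k)) b s) := fun s => by
      rw [← (Fin.snocEquiv fun _ : Fin (k + 1) => A).sum_comp, Fintype.sum_prod_type_right]
      exact Finset.sum_congr rfl fun a _ => Finset.sum_congr rfl fun b _ =>
        M.pathProb_snoc d₀ σ q a s b
    rw [Finset.sum_congr rfl fun s _ => h s, Finset.sum_comm]
    refine Finset.sum_congr rfl fun a _ => ?_
    rw [Finset.sum_comm]
    simp only [← Finset.mul_sum, stdSimplex.sum_eq_one, mul_one]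

/-- The distribution `M^σ_i` over states after `i` steps under the strategy `σ` from `d₀`. -/
noncomputable def dist (M : MDP Q A) (d₀ : stdSimplex ℝ Q) (σ : Strategy Q A) (i : ℕ) :
    stdSimplex ℝ Q :=
  ⟨M.stepProb d₀ σ i,
    fun _ => Finset.sum_nonneg fun _ _ => Finset.sum_nonneg fun _ _ => M.pathProb_nonneg _ _ _ _,
    by
      classical
      simp only [stepProb]
      rw [← M.sum_pathProb d₀ σ i]
      exact Finset.sum_fiberwise _ (fun q : Fin (i + 1) → Q => q (Fin.last i)) _⟩

end Runs

section EndComponents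

variable {Q A : Type*} [Fintype Q]

/-- `A_S(q)`: the actions that keep all successors of `q` in `S`. -/
def actionsIn (M : MDP Q A) (S : Set Q) (q : Q) : Set A := {a | supp (M.δ q a) ⊆ S}

/-- `S` is closed: from each of its states some action stays in `S`. -/
def IsClosedSet (M : MDP Q A) (S : Set Q) : Prop := ∀ q ∈ S, (M.actionsIn S q).Nonempty

/-- The edge relation `E_S` on `S`. -/
def Edge (M : MDP Q A) (S : Set Q) (q q' : Q) : Prop :=
  q ∈ S ∧ q' ∈ S ∧ ∃ a ∈ M.actionsIn S q, 0 < M.δ q a q'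

/-- `S` is an end-component: it is closed and the graph `(S, E_S)` is strongly connected. -/
def IsEndComponent (M : MDP Q A) (S : Set Q) : Prop :=
  M.IsClosedSet S ∧ ∀ q ∈ S, ∀ q' ∈ S, Relation.ReflTransGen (M.Edge S) q q'

/-- `S` is a maximal end-component: no strict superset is an end-component. -/
def IsMaximalEndComponent (M : MDP Q A) (S : Set Q) : Prop :=
  M.IsEndComponent S ∧ ∀ S', S ⊂ S' → ¬ M.IsEndComponent S'

/-- The union of all (maximal) end-components. -/
def endUnion (M : MDP Q A) : Set Q := ⋃₀ {S | M.IsMaximalEndComponent S}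

/-- The maximal end-component that contains `q`, for `q` in `M.endUnion`
(see `isMaximalEndComponent_maxEndComponent`); it is empty for the other states. -/
def maxEndComponent (M : MDP Q A) (q : Q) : Set Q :=
  ⋃₀ {S | M.IsMaximalEndComponent S ∧ q ∈ S}

theorem actionsIn_mono (M : MDP Q A) {S S' : Set Q} (h : S ⊆ S') (q : Q) :
    M.actionsIn S q ⊆ M.actionsIn S' q := fun _ ha => Set.Subset.trans ha h

theorem IsEndComponent.union {M : MDP Q A} {S S' : Set Q} (h : M.IsEndComponent S)
    (h' : M.IsEndComponent S') {q : Q} (hq : q ∈ S) (hq' : q ∈ S') :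
    M.IsEndComponent (S ∪ S') := by
  have lift : ∀ {R : Set Q}, R ⊆ S ∪ S' → ∀ {x y}, Relation.ReflTransGen (M.Edge R) x y →
      Relation.ReflTransGen (M.Edge (S ∪ S')) x y := fun hR _ _ hxy =>
    Relation.ReflTransGen.mono (fun _ _ ⟨h1, h2, a, ha, hp⟩ =>
      ⟨hR h1, hR h2, a, M.actionsIn_mono hR _ ha, hp⟩) _ _ hxy
  have l := @lift S Set.subset_union_left
  have r := @lift S' Set.subset_union_right
  refine ⟨?_, ?_⟩
  · rintro x (hx | hx)
    · exact (h.1 x hx).mono (M.actionsIn_mono Set.subset_union_left x)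
    · exact (h'.1 x hx).mono (M.actionsIn_mono Set.subset_union_right x)
  · have hto : ∀ x ∈ S ∪ S', Relation.ReflTransGen (M.Edge (S ∪ S')) x q := by
      rintro x (hx | hx)
      · exact l (h.2 x hx q hq)
      · exact r (h'.2 x hx q hq')
    have hfro : ∀ x ∈ S ∪ S', Relation.ReflTransGen (M.Edge (S ∪ S')) q x := by
      rintro x (hx | hx)
      · exact l (h.2 q hq x hx)
      · exact r (h'.2 q hq' x hx)
    exact fun x hx y hy => (hto x hx).trans (hfro y hy)

theorem maxEndComponent_eq {M : MDP Q A} {S : Set Q} (hS : M.IsMaximalEndComponent S) {q : Q}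
    (hq : q ∈ S) : M.maxEndComponent q = S := by
  refine Set.Subset.antisymm (Set.sUnion_subset ?_) (Set.subset_sUnion_of_mem ⟨hS, hq⟩)
  rintro S' ⟨hS', hq'⟩ x hx
  by_contra hxS
  exact hS.2 (S ∪ S') ⟨Set.subset_union_left, fun hsub => hxS (hsub (Or.inr hx))⟩
    (hS.1.union hS'.1 hq hq')

theorem isMaximalEndComponent_maxEndComponent {M : MDP Q A} {q : Q} (hq : q ∈ M.endUnion) :
    M.IsMaximalEndComponent (M.maxEndComponent q) ∧ q ∈ M.maxEndComponent q := by
  obtain ⟨S, hS, hqS⟩ := hq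
  rw [maxEndComponent_eq hS hqS]
  exact ⟨hS, hqS⟩

theorem actionsIn_maxEndComponent_nonempty {M : MDP Q A} {q : Q} (hq : q ∈ M.endUnion) :
    (M.actionsIn (M.maxEndComponent q) q).Nonempty :=
  (isMaximalEndComponent_maxEndComponent hq).1.1.1 q (isMaximalEndComponent_maxEndComponent hq).2

end EndComponents

section Strategies

variable {Q A : Type*} [Fintype Q] [Fintype A]

/-- The strategy `σ_u`: at every round, all actions uniformly at random. -/
noncomputable def uniformStrategy (Q A : Type*) [Fintype A] [Nonempty A] : Strategy Q A :=
  fun _ _ _ => uniformOn Set.univ Set.univ_nonempty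

open Classical in
/-- The strategy that in a state `q` of an end-component plays uniformly at random all actions that
stay in the maximal end-component of `q`, and in the other states plays all actions uniformly at
random. -/
noncomputable def stayStrategy [Nonempty A] (M : MDP Q A) : Strategy Q A :=
  fun k q _ =>
    if h : q (Fin.last k) ∈ M.endUnion then
      uniformOn (M.actionsIn (M.maxEndComponent (q (Fin.last k))) (q (Fin.last k)))
        (actionsIn_maxEndComponent_nonempty h)
    else uniformOn Set.univ Set.univ_nonempty

/-- The freezing strategy: play `σ_u` in the first `2 ^ |Q|` rounds, then switch to
`M.stayStrategy`. -/
noncomputable def freezingStrategy [Nonempty A] (M : MDP Q A) : Strategy Q A :=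
  fun k q a =>
    if k < 2 ^ Fintype.card Q then uniformStrategy Q A k q a else M.stayStrategy k q a

end Strategies

section Synchronization

variable {Q A : Type*} [Fintype Q] [Fintype A]

/-- A sequence of distributions is positively always synchronizing in `T`. -/
def PositivelyAlways (d : ℕ → stdSimplex ℝ Q) (T : Set Q) : Prop :=
  ∀ i, 0 < mass (d i) T

/-- A sequence of distributions is boundedly always synchronizing in `T`. -/
def BoundedlyAlways (d : ℕ → stdSimplex ℝ Q) (T : Set Q) : Prop :=
  ∃ ε : ℝ, 0 < ε ∧ ∀ i, ε < mass (d i) T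

/-- A sequence of distributions is boundedly strongly synchronizing in `T`:
`d_i(T) > ε` for all but finitely many `i`. -/
def BoundedlyStrongly (d : ℕ → stdSimplex ℝ Q) (T : Set Q) : Prop :=
  ∃ ε : ℝ, 0 < ε ∧ ∃ N : ℕ, ∀ i ≥ N, ε < mass (d i) T

/-- The initial distributions that are positive winning for always synchronizing in `T`. -/
def winPositiveAlways (M : MDP Q A) (T : Set Q) : Set (stdSimplex ℝ Q) :=
  {d₀ | ∃ σ : Strategy Q A, PositivelyAlways (M.dist d₀ σ) T}

/-- The initial distributions that are bounded winning for always synchronizing in `T`. -/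
def winBoundedAlways (M : MDP Q A) (T : Set Q) : Set (stdSimplex ℝ Q) :=
  {d₀ | ∃ σ : Strategy Q A, BoundedlyAlways (M.dist d₀ σ) T}

/-- The initial distributions that are bounded winning for strongly synchronizing in `T`. -/
def winBoundedStrongly (M : MDP Q A) (T : Set Q) : Set (stdSimplex ℝ Q) :=
  {d₀ | ∃ σ : Strategy Q A, BoundedlyStrongly (M.dist d₀ σ) T}

/-- Condition (1): under `σ_u`, the mass in `T` is positive at every step. -/
def Condition1 [Nonempty A] (M : MDP Q A) (d₀ : stdSimplex ℝ Q) (T : Set Q) : Prop :=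
  ∀ i : ℕ, 0 < mass (M.dist d₀ (uniformStrategy Q A) i) T

/-- Condition (2): under `σ_u`, the mass in `T` intersected with the union of the end-components is
positive at every step `i ≥ 2 ^ |Q|`. -/
def Condition2 [Nonempty A] (M : MDP Q A) (d₀ : stdSimplex ℝ Q) (T : Set Q) : Prop :=
  ∀ i : ℕ, 2 ^ Fintype.card Q ≤ i →
    0 < mass (M.dist d₀ (uniformStrategy Q A) i) (M.endUnion ∩ T)

end Synchronization

end MDP

/-!
* Let `post` send a set of states to the set of their possible successors. For every strategy, the
  support of the distribution after `i` steps is contained in `post^[i] (supp d₀)`, with equality if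
  all actions had positive probability at each of these steps. As a sequence of subsets of `Q`,
  these iterates are periodic from step `2 ^ |Q|` on.
* The state-action frequencies of a strategy satisfy: outflow at step `i + 1` = inflow at step `i`.
  By telescoping, every limit point of their Cesàro means is a stationary flow. Such a flow is a
  circulation, so each edge that carries flow lies on a cycle, and its states lie in
  end-components. Hence the mass outside the end-components tends to `0` in the Cesàro sense, and
  it cannot stay bounded away from `0` along an arithmetic progression.
* After freezing, the process is a Markov chain with transition matrix `P` in which every state of
  an end-component is recurrent. For a suitable `K`, all powers `P ^ (K * m)` with `m > 0` have the
  same zero pattern. So whatever is reached from a recurrent state `q` in `K * m` steps can return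
  to `q` in exactly `K` steps, which bounds `(P ^ (K * m)) q q` from below uniformly in `m`.
-/

open Filter Finset Function Relation Topology
open scoped Matrix

section OrderedSums

theorem exists_pos_forall_lt_of_pos {ι R : Type*} [Finite ι] [Zero R] [LinearOrder R]
    [DenselyOrdered R] [NoMinOrder R] [NoMaxOrder R] (f : ι → R) :
    ∃ c > 0, ∀ i, 0 < f i → c < f i := by
  cases nonempty_fintype ι
  obtain ⟨c, hlow, hhigh⟩ := Order.exists_between_finsets {0} {x ∈ univ.image f | 0 < x} (by simp)
  exact ⟨c, by simpa using hlow, fun i hi => hhigh (f i) (by simp [hi])⟩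

theorem exists_pos_forall_lt_of_arithmetic_progressions {R : Type*} [Zero R] [LinearOrder R]
    [DenselyOrdered R] [NoMinOrder R] [NoMaxOrder R] {f : ℕ → R} {k : ℕ} (hk : 0 < k)
    (h : ∀ r, ∃ c > 0, ∀ m, c ≤ f (r + k * m)) : ∃ ε > 0, ∀ i, ε < f i := by
  choose c hc hle using h
  obtain ⟨ε, hε, hlt⟩ := exists_pos_forall_lt_of_pos fun r : Fin k => c r
  refine ⟨ε, hε, fun i => (hlt ⟨i % k, Nat.mod_lt i hk⟩ (hc _)).trans_le ?_⟩
  simpa only [Nat.mod_add_div] using hle (i % k) (i / k)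

theorem sum_mul_pos_iff {ι R : Type*} [Fintype ι] [Ring R] [LinearOrder R] [IsStrictOrderedRing R]
    {f g : ι → R} (hf : ∀ i, 0 ≤ f i) (hg : ∀ i, 0 ≤ g i) :
    0 < ∑ i, f i * g i ↔ ∃ i, 0 < f i ∧ 0 < g i := by
  rw [sum_pos_iff_of_nonneg fun i _ => mul_nonneg (hf i) (hg i)]
  simp only [mem_univ, true_and]
  exact exists_congr fun i =>
    ⟨fun h => ⟨pos_of_mul_pos_left h (hg i), pos_of_mul_pos_right h (hf i)⟩,
      fun h => mul_pos h.1 h.2⟩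

theorem sum_pi_eq_sum_snoc {X β : Type*} [Fintype X] [AddCommMonoid β] {n : ℕ}
    (f : (Fin (n + 1) → X) → β) :
    ∑ q, f q = ∑ q : Fin n → X, ∑ s, f (Fin.snoc (α := fun _ => X) q s) := by
  rw [← (Fin.snocEquiv fun _ : Fin (n + 1) => X).sum_comp, Fintype.sum_prod_type_right]
  rfl

end OrderedSums

section PeriodicIterates

theorem iterate_mem_periodicPts_of_card_le {X : Type*} [Fintype X] (f : X → X) (x : X) {i : ℕ}
    (hi : Fintype.card X ≤ i) : f^[i] x ∈ periodicPts f := by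
  obtain ⟨a, b, hne, heq⟩ := Fintype.exists_ne_map_eq_of_card_lt
    (fun j : Fin (Fintype.card X + 1) => f^[j] x) (by simp)
  wlog hab : a < b generalizing a b
  · exact this b a hne.symm heq.symm (lt_of_le_of_ne (not_lt.1 hab) hne.symm)
  have hperiodic : IsPeriodicPt f (b - a) (f^[a] x) := by
    rw [IsPeriodicPt, IsFixedPt, ← iterate_add_apply, Nat.sub_add_cancel (Fin.le_def.1 hab.le)]
    exact heq.symm
  rw [← Nat.sub_add_cancel (show (a : ℕ) ≤ i by omega), iterate_add_apply]
  exact mk_mem_periodicPts (Nat.sub_pos_of_lt hab) (hperiodic.apply_iterate _)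

/-- A common period, from step `2 ^ |Q|` on, of the orbits of all self-maps of the power set of `Q`:
every cycle of such a map has at most `2 ^ |Q|` elements, so its length divides this factorial. -/
def supportPeriod (Q : Type*) [Fintype Q] : ℕ := (2 ^ Fintype.card Q).factorial

theorem supportPeriod_pos (Q : Type*) [Fintype Q] : 0 < supportPeriod Q := Nat.factorial_pos _

theorem two_pow_card_le_supportPeriod (Q : Type*) [Fintype Q] :
    2 ^ Fintype.card Q ≤ supportPeriod Q := Nat.self_le_factorial _

theorem iterate_add_supportPeriod_mul {Q : Type*} [Fintype Q] (f : Set Q → Set Q) (S : Set Q)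
    {i : ℕ} (hi : 2 ^ Fintype.card Q ≤ i) (m : ℕ) :
    f^[i + supportPeriod Q * m] S = f^[i] S := by
  classical
  rw [← Fintype.card_set] at hi
  have hperiodic :=
    isPeriodicPt_factorial_card_of_mem_periodicPts (iterate_mem_periodicPts_of_card_le f S hi)
  rw [Fintype.card_set] at hperiodic
  rw [add_comm, iterate_add_apply]
  exact (hperiodic.mul_const m).eq

end PeriodicIterates

section Circulations

variable {V α : Type*} [Fintype V] [AddCommMonoid α] [PartialOrder α] [IsOrderedCancelAddMonoid α]
  {w : V → V → α}

theorem mem_of_circulation (hw : ∀ s t, 0 ≤ w s t) (hbal : ∀ s, ∑ t, w t s = ∑ t, w s t)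
    {R : Finset V} (hR : ∀ s ∈ R, ∀ t, 0 < w s t → t ∈ R) {s t : V} (hst : 0 < w s t)
    (ht : t ∈ R) : s ∈ R := by
  classical
  have hout : ∑ u ∈ R, ∑ v, w u v = ∑ v ∈ R, ∑ u ∈ R, w u v := by
    rw [sum_comm (s := R) (t := R)]
    refine sum_congr rfl fun u hu => (sum_subset (subset_univ R) fun v _ hv => ?_).symm
    exact ((hw u v).eq_or_lt.resolve_right fun h => hv (hR u hu v h)).symm
  have hin : ∑ v ∈ R, ∑ u, w u v = ∑ v ∈ R, ∑ u ∈ R, w u v + ∑ v ∈ R, ∑ u ∈ Rᶜ, w u v := by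
    simp only [← sum_add_distrib, sum_add_sum_compl]
  have hzero : ∑ v ∈ R, ∑ u ∈ Rᶜ, w u v = 0 := by
    rw [sum_congr rfl fun v _ => hbal v, hout] at hin
    exact left_eq_add.1 hin
  by_contra hs
  have hcol := (sum_eq_zero_iff_of_nonneg fun v _ => sum_nonneg fun u _ => hw u v).1 hzero t ht
  exact hst.ne' ((sum_eq_zero_iff_of_nonneg fun u _ => hw u t).1 hcol s (by simpa using hs))

theorem reflTransGen_symm_of_circulation (hw : ∀ s t, 0 ≤ w s t)
    (hbal : ∀ s, ∑ t, w t s = ∑ t, w s t) {s t : V}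
    (hst : ReflTransGen (fun u v => 0 < w u v) s t) :
    ReflTransGen (fun u v => 0 < w u v) t s := by
  classical
  have hback {u v : V} (huv : 0 < w u v) (hv : ReflTransGen (fun u v => 0 < w u v) t v) :
      ReflTransGen (fun u v => 0 < w u v) t u := by
    simpa using mem_of_circulation hw hbal (R := {x | ReflTransGen (fun u v => 0 < w u v) t x})
      (fun x hx y hxy => by simpa using (mem_filter.1 hx).2.tail hxy) huv (by simpa using hv)
  induction hst using ReflTransGen.head_induction_on with
  | refl => exact .refl
  | head hedge _ ih => exact hback hedge ih

end Circulations

section CesaroMeans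

variable {E F G : Type*} [NormedAddCommGroup E] [NormedSpace ℝ E] [NormedAddCommGroup F]
  [NormedSpace ℝ F] [NormedAddCommGroup G] [NormedSpace ℝ G]

theorem cesaro_mem_of_convex {K : Set E} (hK : Convex ℝ K) {y : ℕ → E} (hy : ∀ i, y i ∈ K) {n : ℕ}
    (hn : n ≠ 0) : (n : ℝ)⁻¹ • ∑ i ∈ range n, y i ∈ K := by
  rw [smul_sum]
  exact hK.sum_mem (fun _ _ => by positivity) (by simp [hn]) fun i _ => hy i

/-- By telescoping, the Cesàro means of `y` satisfy `f x = g x` up to an error of order `1 / n`. -/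
theorem tendsto_cesaro_of_equalizer {K : Set E} (hK : IsCompact K) (hconv : Convex ℝ K)
    {y : ℕ → E} (hy : ∀ i, y i ∈ K) {f g : E →L[ℝ] F} (hstep : ∀ i, f (y (i + 1)) = g (y i))
    {φ : E →L[ℝ] G} {c : G} (hφ : ∀ x ∈ K, f x = g x → φ x = c) :
    Tendsto (fun n : ℕ => (n : ℝ)⁻¹ • ∑ i ∈ range n, φ (y i)) atTop (𝓝 c) := by
  set u : ℕ → E := fun n => (n : ℝ)⁻¹ • ∑ i ∈ range n, y i
  have hdefect : Tendsto (fun n => g (u n) - f (u n)) atTop (𝓝 0) := by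
    have htelescope (n : ℕ) : g (u n) - f (u n) = (n : ℝ)⁻¹ • (f (y n) - f (y 0)) := by
      simp only [u, map_smul, map_sum, ← smul_sub, ← hstep, ← sum_sub_distrib,
        sum_range_sub fun i => f (y i)]
    obtain ⟨C, hC⟩ := (hK.image f.continuous).isBounded.exists_norm_le
    have hbound (i : ℕ) : ‖f (y i)‖ ≤ C := hC _ ⟨y i, hy i, rfl⟩
    simp only [htelescope]
    exact tendsto_inv_atTop_nhds_zero_nat.zero_smul_isBoundedUnder_le <|
      isBoundedUnder_of ⟨C + C, fun n => (norm_sub_le _ _).trans (add_le_add (hbound n) (hbound 0))⟩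
  have hu : ∀ᶠ n in atTop, u n ∈ K :=
    (eventually_ne_atTop 0).mono fun n hn => cesaro_mem_of_convex hconv hy hn
  have hmean (n : ℕ) : (n : ℝ)⁻¹ • ∑ i ∈ range n, φ (y i) = φ (u n) := by
    simp only [u, map_smul, map_sum]
  simp only [hmean]
  refine tendsto_of_subseq_tendsto fun ns hns => ?_
  obtain ⟨x, hxK, ψ, hψ, hlim⟩ := hK.tendsto_subseq' (hns.eventually hu).frequently
  have hx : f x = g x := by
    have hlimit : Tendsto (fun n => g (u (ns (ψ n))) - f (u (ns (ψ n)))) atTop (𝓝 (g x - f x)) :=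
      ((g.continuous.tendsto x).comp hlim).sub ((f.continuous.tendsto x).comp hlim)
    exact (sub_eq_zero.1 (tendsto_nhds_unique hlimit
      (hdefect.comp (hns.comp hψ.tendsto_atTop)))).symm
  exact ⟨ψ, hφ x hxK hx ▸ (φ.continuous.tendsto x).comp hlim⟩

theorem exists_lt_of_tendsto_cesaro_zero {f : ℕ → ℝ} (hf : ∀ i, 0 ≤ f i)
    (hlim : Tendsto (fun n : ℕ => (n : ℝ)⁻¹ • ∑ i ∈ range n, f i) atTop (𝓝 0)) (k : ℕ) {p : ℕ}
    (hp : 0 < p) {ε : ℝ} (hε : 0 < ε) : ∃ m, f (k + p * m) < ε := by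
  by_contra! hle
  have hsum (n : ℕ) : n * ε ≤ ∑ i ∈ range (k + p * n), f i := by
    have hinj : Set.InjOn (fun m => k + p * m) (range n) := fun a _ b _ hab =>
      Nat.eq_of_mul_eq_mul_left hp (Nat.add_left_cancel hab)
    calc n * ε = ∑ _ ∈ range n, ε := by simp
      _ ≤ ∑ m ∈ range n, f (k + p * m) := sum_le_sum fun _ _ => hle _
      _ = ∑ i ∈ (range n).image (fun m => k + p * m), f i := (sum_image hinj).symm
      _ ≤ ∑ i ∈ range (k + p * n), f i := by
          refine sum_le_sum_of_subset_of_nonneg (image_subset_iff.2 fun _ hm => ?_)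
            fun i _ _ => hf i
          have := Nat.mul_lt_mul_of_pos_left (mem_range.1 hm) hp
          exact mem_range.2 (by omega)
  have hprogression : Tendsto (fun n => k + p * n) atTop atTop :=
    tendsto_atTop_mono
      (fun n => (Nat.le_mul_of_pos_left n hp).trans (Nat.le_add_left _ k)) tendsto_id
  obtain ⟨n, hlt, hn⟩ := (((hlim.comp hprogression).eventually_lt_const
    (show (0 : ℝ) < ε / (p + 1) by positivity)).and (eventually_gt_atTop k)).exists
  have hn' : (k : ℝ) < n := by exact_mod_cast hn
  have hlen : (0 : ℝ) < (k + p * n : ℕ) := by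
    push_cast
    have : (0 : ℝ) < p := by exact_mod_cast hp
    have : (0 : ℝ) ≤ k := k.cast_nonneg
    nlinarith
  rw [comp_apply, smul_eq_mul, inv_mul_lt_iff₀ hlen, mul_div_assoc', lt_div_iff₀ (by positivity)]
    at hlt
  have hcount : ((k + p * n : ℕ) : ℝ) ≤ n * (p + 1) := by push_cast; linarith
  nlinarith [hsum n]

end CesaroMeans

section RecurrentStates

variable {Q R : Type*} [Fintype Q] [DecidableEq Q]

section Ring

variable [Ring R] [LinearOrder R] [IsStrictOrderedRing R] {P : Matrix Q Q R}

theorem pow_add_apply_pos_iff (hP : ∀ s t, 0 ≤ P s t) {k l : ℕ} {s t : Q} :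
    0 < (P ^ (k + l)) s t ↔ ∃ u, 0 < (P ^ k) s u ∧ 0 < (P ^ l) u t := by
  rw [pow_add, Matrix.mul_apply,
    sum_mul_pos_iff (Matrix.pow_apply_nonneg hP k s) fun u => Matrix.pow_apply_nonneg hP l u t]

theorem pow_mul_apply_self_pos (hP : ∀ s t, 0 ≤ P s t) {l : ℕ} {q : Q} (hq : 0 < (P ^ l) q q)
    (m : ℕ) : 0 < (P ^ (l * m)) q q := by
  induction m with
  | zero => simp
  | succ m ih => exact (pow_add_apply_pos_iff hP).2 ⟨q, ih, hq⟩

theorem pow_zero_apply_pos_iff {s t : Q} : 0 < (P ^ 0) s t ↔ s = t := by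
  by_cases hst : s = t <;> simp [hst]

theorem exists_pow_apply_pos_iff_reflTransGen (hP : ∀ s t, 0 ≤ P s t) {s t : Q} :
    (∃ l, 0 < (P ^ l) s t) ↔ ReflTransGen (fun u v => 0 < P u v) s t := by
  constructor
  · rintro ⟨l, hl⟩
    induction l generalizing t with
    | zero =>
      obtain rfl := pow_zero_apply_pos_iff.1 hl
      exact .refl
    | succ l ih =>
      obtain ⟨u, hsu, hut⟩ := (pow_add_apply_pos_iff hP).1 hl
      exact (ih hsu).tail (by simpa using hut)
  · intro h
    induction h with
    | refl => exact ⟨0, by simp⟩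
    | tail _ huv ih =>
      obtain ⟨l, hl⟩ := ih
      exact ⟨l + 1, (pow_add_apply_pos_iff hP).2 ⟨_, hl, by simpa using huv⟩⟩

theorem row_support_pow_eq_iterate (hP : ∀ s t, 0 ≤ P s t) (s : Q) (l : ℕ) :
    {t | 0 < (P ^ l) s t} = (fun S => {t | ∃ u ∈ S, 0 < P u t})^[l] {s} := by
  induction l with
  | zero =>
    ext t
    exact pow_zero_apply_pos_iff.trans eq_comm
  | succ l ih =>
    rw [iterate_succ_apply', ← ih]
    ext t
    simp [pow_add_apply_pos_iff hP]

theorem pow_supportPeriod_mul_apply_pos_iff (hP : ∀ s t, 0 ≤ P s t) {m : ℕ} (hm : 0 < m)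
    {s t : Q} : 0 < (P ^ (supportPeriod Q * m)) s t ↔ 0 < (P ^ supportPeriod Q) s t := by
  obtain ⟨m, rfl⟩ := Nat.exists_eq_succ_of_ne_zero hm.ne'
  have hsupport : {t | 0 < (P ^ (supportPeriod Q * (m + 1))) s t} =
      {t | 0 < (P ^ supportPeriod Q) s t} := by
    rw [row_support_pow_eq_iterate hP, row_support_pow_eq_iterate hP, mul_add_one,
      add_comm, iterate_add_supportPeriod_mul _ _ (two_pow_card_le_supportPeriod Q)]
  exact Set.ext_iff.1 hsupport t

/-- A state `q` of the Markov chain with transition matrix `P` is recurrent: it can be reached, in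
at least one step, from every state that can be reached from it. -/
def IsRecurrent (P : Matrix Q Q R) (q : Q) : Prop :=
  ∀ l t, 0 < (P ^ l) q t → ∃ m > 0, 0 < (P ^ m) t q

theorem IsRecurrent.pow_supportPeriod_apply_pos (hP : ∀ s t, 0 ≤ P s t) {q t : Q}
    (hq : IsRecurrent P q) {m : ℕ} (ht : 0 < (P ^ (supportPeriod Q * m)) q t) :
    0 < (P ^ supportPeriod Q) t q := by
  obtain ⟨l, hl, htq⟩ := hq _ t ht
  obtain ⟨j, hj⟩ := Nat.exists_eq_add_of_lt (supportPeriod_pos Q)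
  have hloop : 0 < (P ^ (supportPeriod Q * m + l)) q q := (pow_add_apply_pos_iff hP).2 ⟨t, ht, htq⟩
  have hreturn : 0 < (P ^ (l + (supportPeriod Q * m + l) * j)) t q :=
    (pow_add_apply_pos_iff hP).2 ⟨q, htq, pow_mul_apply_self_pos hP hloop j⟩
  refine (pow_supportPeriod_mul_apply_pos_iff hP (Nat.add_pos_left hl (m * j))).1 ?_
  convert hreturn using 2
  rw [hj]
  ring

end Ring

theorem IsRecurrent.exists_le_pow_supportPeriod_mul [Field R] [LinearOrder R]
    [IsStrictOrderedRing R] {P : Matrix Q Q R} (hP : P ∈ Matrix.rowStochastic R Q) {q : Q}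
    (hq : IsRecurrent P q) : ∃ c > 0, ∀ m, c ≤ (P ^ (supportPeriod Q * m)) q q := by
  have hnonneg (s t : Q) : 0 ≤ P s t := Matrix.nonneg_of_mem_rowStochastic hP
  obtain ⟨c, hc, hlt⟩ := exists_pos_forall_lt_of_pos fun s => (P ^ supportPeriod Q) s q
  refine ⟨c, hc, fun m => ?_⟩
  cases m with
  | zero =>
    have hself := hlt q (hq.pow_supportPeriod_apply_pos hnonneg (m := 0) (by simp))
    simpa using hself.le.trans (Matrix.le_one_of_mem_rowStochastic (pow_mem hP _))
  | succ m =>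
    have hmem := pow_mem hP (supportPeriod Q * m)
    calc c = ∑ s, (P ^ (supportPeriod Q * m)) q s * c := by
          rw [← sum_mul, Matrix.sum_row_of_mem_rowStochastic hmem, one_mul]
      _ ≤ ∑ s, (P ^ (supportPeriod Q * m)) q s * (P ^ supportPeriod Q) s q := by
          refine sum_le_sum fun s _ => ?_
          rcases (Matrix.nonneg_of_mem_rowStochastic hmem (i := q) (j := s)).eq_or_lt with h | h
          · simp [← h]
          · have hs := hlt s (hq.pow_supportPeriod_apply_pos hnonneg h)
            exact mul_le_mul_of_nonneg_left hs.le h.le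
      _ = (P ^ (supportPeriod Q * (m + 1))) q q := by
          rw [mul_add_one, pow_add, Matrix.mul_apply]

end RecurrentStates

namespace MDP

section Masses

variable {X : Type*} [Fintype X] {d : stdSimplex ℝ X}

theorem mass_nonneg (T : Set X) : 0 ≤ mass d T := sum_nonneg fun x _ => stdSimplex.zero_le d x

theorem mass_pos_iff {T : Set X} : 0 < mass d T ↔ ∃ x ∈ T, x ∈ supp d := by
  classical
  rw [mass, sum_pos_iff_of_nonneg fun x _ => stdSimplex.zero_le d x]
  simp [supp]

theorem apply_le_mass {T : Set X} {x : X} (hx : x ∈ T) : d x ≤ mass d T := by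
  classical
  exact single_le_sum (f := fun y => d y) (fun y _ => stdSimplex.zero_le d y) (by simpa using hx)

theorem mass_le_mass_inter_add_mass_compl (S T : Set X) :
    mass d T ≤ mass d (S ∩ T) + mass d Sᶜ := by
  classical
  simp only [mass, sum_filter, ← sum_add_distrib]
  refine sum_le_sum fun x _ => ?_
  by_cases hS : x ∈ S <;> by_cases hT : x ∈ T <;> simp [hS, hT]

theorem uniformOn_pos_iff {s : Set X} {hs : s.Nonempty} {x : X} :
    0 < uniformOn s hs x ↔ x ∈ s := by
  classical
  change 0 < (if x ∈ s then (s.ncard : ℝ)⁻¹ else 0) ↔ x ∈ s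
  split_ifs with h
  · simpa [h, Nat.pos_iff_ne_zero] using (Set.ncard_pos s.toFinite).2 hs |>.ne'
  · simp [h]

end Masses

section StateActionFrequencies

variable {Q A : Type*} [Fintype Q] [Fintype A] {M : MDP Q A} {d₀ : stdSimplex ℝ Q}
  {σ : Strategy Q A} {i : ℕ} {s t : Q} {b : A}

theorem dist_apply (s : Q) : M.dist d₀ σ i s = M.stepProb d₀ σ i s := rfl

open Classical in
/-- The probability of being in state `s` after `i` steps and of playing the action `b` there. -/
noncomputable def stateActionProb (M : MDP Q A) (d₀ : stdSimplex ℝ Q) (σ : Strategy Q A) (i : ℕ)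
    (s : Q) (b : A) : ℝ :=
  ∑ q : Fin (i + 1) → Q with q (Fin.last i) = s, ∑ a : Fin i → A, M.pathProb d₀ σ q a * σ i q a b

theorem stateActionProb_nonneg : 0 ≤ M.stateActionProb d₀ σ i s b :=
  sum_nonneg fun _ _ => sum_nonneg fun _ _ =>
    mul_nonneg (M.pathProb_nonneg _ _ _ _) (stdSimplex.zero_le _ _)

theorem sum_stateActionProb (s : Q) :
    ∑ b, M.stateActionProb d₀ σ i s b = M.dist d₀ σ i s := by
  simp only [stateActionProb]
  rw [sum_comm]
  refine sum_congr rfl fun q _ => ?_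
  rw [sum_comm]
  simp only [← mul_sum, stdSimplex.sum_eq_one, mul_one]

theorem stateActionProb_of_memoryless {τ : Q → stdSimplex ℝ A}
    (hτ : ∀ q a, σ i q a = τ (q (Fin.last i))) :
    M.stateActionProb d₀ σ i s b = M.dist d₀ σ i s * τ s b := by
  classical
  rw [dist_apply, stepProb, stateActionProb, sum_mul]
  refine sum_congr rfl fun q hq => ?_
  simp only [hτ, (mem_filter.1 hq).2, sum_mul]

theorem stateActionProb_pos (hs : 0 < M.dist d₀ σ i s) (hσ : ∀ q a, 0 < σ i q a b) :
    0 < M.stateActionProb d₀ σ i s b := by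
  obtain ⟨q, hq, hpath⟩ := exists_ne_zero_of_sum_ne_zero hs.ne'
  obtain ⟨a, ha, hpos⟩ := exists_ne_zero_of_sum_ne_zero hpath
  have hnonneg (q a) : 0 ≤ M.pathProb d₀ σ q a * σ i q a b :=
    mul_nonneg (M.pathProb_nonneg _ _ _ _) (stdSimplex.zero_le _ _)
  refine sum_pos' (fun _ _ => sum_nonneg fun _ _ => hnonneg _ _) ⟨q, hq, ?_⟩
  exact sum_pos' (fun _ _ => hnonneg _ _)
    ⟨a, ha, mul_pos ((M.pathProb_nonneg d₀ σ q a).lt_of_ne' hpos) (hσ q a)⟩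

theorem sum_stateActionProb_mul (f : Q → A → ℝ) :
    ∑ s, ∑ b, M.stateActionProb d₀ σ i s b * f s b =
      ∑ q : Fin (i + 1) → Q, ∑ a : Fin i → A, ∑ b,
        M.pathProb d₀ σ q a * σ i q a b * f (q (Fin.last i)) b := by
  classical
  rw [← sum_fiberwise (g := fun q : Fin (i + 1) → Q => q (Fin.last i))]
  refine sum_congr rfl fun s _ => ?_
  simp only [stateActionProb, sum_mul]
  rw [sum_comm]
  refine sum_congr rfl fun q hq => ?_
  rw [sum_comm, (mem_filter.1 hq).2]

theorem dist_succ (t : Q) :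
    M.dist d₀ σ (i + 1) t = ∑ s, ∑ b, M.stateActionProb d₀ σ i s b * M.δ s b t := by
  classical
  rw [sum_stateActionProb_mul, dist_apply, stepProb, sum_filter, sum_pi_eq_sum_snoc]
  refine sum_congr rfl fun q _ => ?_
  simp only [Fin.snoc_last, sum_ite_eq', mem_univ, if_true]
  rw [sum_pi_eq_sum_snoc]
  simp only [pathProb_snoc, mul_assoc]

theorem mem_supp_dist_succ_iff : t ∈ supp (M.dist d₀ σ (i + 1)) ↔
    ∃ s b, 0 < M.stateActionProb d₀ σ i s b ∧ 0 < M.δ s b t := by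
  change 0 < M.dist d₀ σ (i + 1) t ↔ _
  rw [dist_succ, ← Fintype.sum_prod_type',
    sum_mul_pos_iff (f := fun x : Q × A => M.stateActionProb d₀ σ i x.1 x.2)
      (fun _ => stateActionProb_nonneg) fun x => stdSimplex.zero_le (M.δ x.1 x.2) t]
  exact Prod.exists

theorem dist_zero : M.dist d₀ σ 0 = d₀ := by
  classical
  ext s
  rw [dist_apply, stepProb, sum_filter, sum_pi_eq_sum_snoc]
  simp [pathProb, Fin.snoc]

end StateActionFrequencies

section Supports

variable {Q A : Type*} [Fintype Q] {M : MDP Q A}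

/-- The possible successors of the states in `S`, over all actions. -/
def post (M : MDP Q A) (S : Set Q) : Set Q := {t | ∃ s ∈ S, ∃ b, 0 < M.δ s b t}

theorem post_mono : Monotone M.post := fun _ _ h _ ⟨s, hs, hst⟩ => ⟨s, h hs, hst⟩

variable [Fintype A] {d₀ : stdSimplex ℝ Q} {σ : Strategy Q A}

theorem supp_dist_subset_iterate_post (i : ℕ) :
    supp (M.dist d₀ σ i) ⊆ M.post^[i] (supp d₀) := by
  induction i with
  | zero => rw [dist_zero, iterate_zero_apply]
  | succ i ih =>
    rw [iterate_succ_apply']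
    refine Set.Subset.trans (fun t ht => ?_) (post_mono ih)
    obtain ⟨s, b, hsb, hbt⟩ := mem_supp_dist_succ_iff.1 ht
    refine ⟨s, ?_, b, hbt⟩
    rw [supp, Set.mem_ofPred, ← sum_stateActionProb]
    exact sum_pos' (fun _ _ => stateActionProb_nonneg) ⟨b, mem_univ b, hsb⟩

theorem supp_dist_eq_iterate_post {i : ℕ} (hσ : ∀ j < i, ∀ q a b, 0 < σ j q a b) :
    supp (M.dist d₀ σ i) = M.post^[i] (supp d₀) := by
  refine (supp_dist_subset_iterate_post i).antisymm ?_
  induction i with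
  | zero => rw [dist_zero, iterate_zero_apply]
  | succ i ih =>
    rw [iterate_succ_apply']
    refine Set.Subset.trans (post_mono (ih fun j hj => hσ j (by omega))) ?_
    rintro t ⟨s, hs, b, hbt⟩
    exact mem_supp_dist_succ_iff.2
      ⟨s, b, stateActionProb_pos hs fun q a => hσ i i.lt_succ_self q a b, hbt⟩

variable [Nonempty A]

theorem supp_dist_uniformStrategy (i : ℕ) :
    supp (M.dist d₀ (uniformStrategy Q A) i) = M.post^[i] (supp d₀) :=
  supp_dist_eq_iterate_post fun _ _ _ _ _ => uniformOn_pos_iff.2 (Set.mem_univ _)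

theorem supp_dist_freezingStrategy {i : ℕ} (hi : i ≤ 2 ^ Fintype.card Q) :
    supp (M.dist d₀ M.freezingStrategy i) = M.post^[i] (supp d₀) :=
  supp_dist_eq_iterate_post fun j hj q a b => by
    rw [freezingStrategy, if_pos (hj.trans_le hi)]
    exact uniformOn_pos_iff.2 (Set.mem_univ _)

end Supports

section EndComponents

variable {Q A : Type*} [Fintype Q] {M : MDP Q A}

theorem IsEndComponent.subset_endUnion {S : Set Q} (hS : M.IsEndComponent S) :
    S ⊆ M.endUnion := by
  obtain ⟨S', hSS', hS'⟩ :=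
    (Set.toFinite {S | M.IsEndComponent S}).exists_le_maximal (Set.mem_ofPred.2 hS)
  have hmax : M.IsMaximalEndComponent S' := ⟨hS'.prop, fun _ h hU => h.not_subset (hS'.2 hU h.1)⟩
  exact hSS'.trans (Set.subset_sUnion_of_mem hmax)

theorem isEndComponent_of_selection {S : Set Q} (B : Q → Set A) (hne : ∀ s ∈ S, (B s).Nonempty)
    (hB : ∀ s ∈ S, B s ⊆ M.actionsIn S s)
    (hconn : ∀ s ∈ S, ∀ t ∈ S, ReflTransGen (fun u v => ∃ b ∈ B u, 0 < M.δ u b v) s t) :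
    M.IsEndComponent S := by
  refine ⟨fun s hs => (hne s hs).mono (hB s hs), fun s hs t ht => ?_⟩
  have hst := hconn s hs t ht
  induction hst using ReflTransGen.head_induction_on with
  | refl => exact .refl
  | head huv _ ih =>
    obtain ⟨b, hb, huv⟩ := huv
    have hv := hB _ hs hb huv
    exact (ih hv).head ⟨hs, hv, b, hB _ hs hb, huv⟩

end EndComponents

section Flows

variable {Q A : Type*} [Fintype A]

/-- The total flow out of each state, for a flow `x` giving the amount `x s b` that leaves the state
`s` through the action `b`. -/
def outflow : (Q → A → ℝ) →ₗ[ℝ] Q → ℝ where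
  toFun x s := ∑ b, x s b
  map_add' x y := by ext s; simp [sum_add_distrib]
  map_smul' c x := by ext s; simp [mul_sum]

theorem outflow_apply (x : Q → A → ℝ) (s : Q) : outflow x s = ∑ b, x s b := rfl

variable [Fintype Q] {M : MDP Q A}

/-- The total flow into each state, when the amount `x s b` that leaves `s` through `b` is spread
over the successors of `s` according to `δ`. -/
def inflow (M : MDP Q A) : (Q → A → ℝ) →ₗ[ℝ] Q → ℝ where
  toFun x t := ∑ s, ∑ b, x s b * M.δ s b t
  map_add' x y := by ext t; simp [add_mul, sum_add_distrib]
  map_smul' c x := by ext t; simp [mul_sum, mul_assoc]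

theorem inflow_apply (x : Q → A → ℝ) (t : Q) :
    M.inflow x t = ∑ s, ∑ b, x s b * M.δ s b t := rfl

/-- The states reachable along a stationary flow form an end-component: the flow is a circulation,
so every edge that carries flow lies on a cycle of such edges. -/
theorem mem_endUnion_of_outflow_eq_inflow {x : Q → A → ℝ} (hx : ∀ s b, 0 ≤ x s b)
    (hbal : outflow x = M.inflow x) {q : Q} (hq : 0 < outflow x q) : q ∈ M.endUnion := by
  set w : Q → Q → ℝ := fun s t => ∑ b, x s b * M.δ s b t
  have hw (s t) : 0 ≤ w s t :=
    sum_nonneg fun b _ => mul_nonneg (hx s b) (stdSimplex.zero_le _ _)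
  have hedge {s t} : 0 < w s t ↔ ∃ b, 0 < x s b ∧ 0 < M.δ s b t :=
    sum_mul_pos_iff (hx s) fun b => stdSimplex.zero_le (M.δ s b) t
  have hout (s : Q) : ∑ t, w s t = outflow x s := by
    rw [sum_comm, outflow_apply]
    simp only [← mul_sum, stdSimplex.sum_eq_one, mul_one]
  have hcirculation (s : Q) : ∑ t, w t s = ∑ t, w s t := by
    rw [hout, hbal, inflow_apply]
  have hsymm {s t} := reflTransGen_symm_of_circulation hw hcirculation (s := s) (t := t)
  refine (isEndComponent_of_selection (S := {s | ReflTransGen (fun u v => 0 < w u v) q s})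
    (fun s => {b | 0 < x s b}) (fun s hs => ?_) (fun s hs b hb t ht => ?_)
    fun s hs t ht => ?_).subset_endUnion .refl
  · rcases (hsymm hs).cases_head with rfl | ⟨t, hst, -⟩
    · obtain ⟨b, -, hb⟩ := (sum_pos_iff_of_nonneg fun b _ => hx s b).1 hq
      exact ⟨b, hb⟩
    · exact (hedge.1 hst).imp fun _ => And.left
  · exact hs.tail (hedge.2 ⟨b, hb, ht⟩)
  · exact ReflTransGen.mono (fun _ _ => hedge.1) _ _ ((hsymm hs).trans ht)

section LongRun

variable {d₀ : stdSimplex ℝ Q} {σ : Strategy Q A}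

theorem outflow_stateActionProb (i : ℕ) :
    outflow (M.stateActionProb d₀ σ i) = M.dist d₀ σ i := funext sum_stateActionProb

theorem inflow_stateActionProb (i : ℕ) :
    M.inflow (M.stateActionProb d₀ σ i) = M.dist d₀ σ (i + 1) := (funext dist_succ).symm

theorem stateActionProb_mem_Icc (i : ℕ) : M.stateActionProb d₀ σ i ∈ Set.Icc 0 1 := by
  refine ⟨fun s b => stateActionProb_nonneg, fun s b => ?_⟩
  calc M.stateActionProb d₀ σ i s b ≤ ∑ b, M.stateActionProb d₀ σ i s b :=
        single_le_sum (f := M.stateActionProb d₀ σ i s) (fun _ _ => stateActionProb_nonneg)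
          (mem_univ b)
    _ = M.dist d₀ σ i s := sum_stateActionProb s
    _ ≤ 1 := stdSimplex.le_one _ s

theorem tendsto_cesaro_mass_compl_endUnion (M : MDP Q A) (d₀ : stdSimplex ℝ Q)
    (σ : Strategy Q A) :
    Tendsto (fun n : ℕ => (n : ℝ)⁻¹ • ∑ i ∈ range n, mass (M.dist d₀ σ i) M.endUnionᶜ)
      atTop (𝓝 0) := by
  classical
  let massOutside : (Q → A → ℝ) →L[ℝ] ℝ := LinearMap.toContinuousLinearMap
    ((∑ s with s ∈ M.endUnionᶜ, LinearMap.proj s) ∘ₗ outflow)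
  have hmass (i : ℕ) :
      massOutside (M.stateActionProb d₀ σ i) = mass (M.dist d₀ σ i) M.endUnionᶜ := by
    simp [massOutside, outflow_stateActionProb, mass]
  simp only [← hmass]
  refine tendsto_cesaro_of_equalizer (f := outflow.toContinuousLinearMap)
    (g := M.inflow.toContinuousLinearMap) (isCompact_Icc (a := 0) (b := 1)) (convex_Icc 0 1)
    stateActionProb_mem_Icc (fun i => ?_) fun x hx hbal => ?_
  · simp [outflow_stateActionProb, inflow_stateActionProb]
  · suffices ∀ s ∉ M.endUnion, outflow x s = 0 by
      simpa [massOutside] using sum_eq_zero (by simpa using this)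
    intro s hs
    have hnonneg : 0 ≤ outflow x s := sum_nonneg fun b _ => hx.1 s b
    exact (hnonneg.eq_or_lt.resolve_right fun hpos =>
      hs (mem_endUnion_of_outflow_eq_inflow hx.1 (by simpa using hbal) hpos)).symm

end LongRun

end Flows

section Freezing

variable {Q A : Type*} [Fintype Q] [Fintype A] [Nonempty A] {M : MDP Q A} {d₀ : stdSimplex ℝ Q}

open Classical in
/-- The distribution over actions that `M.stayStrategy` plays in the state `q`. -/
noncomputable def stayDist (M : MDP Q A) (q : Q) : stdSimplex ℝ A :=
  if h : q ∈ M.endUnion then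
    uniformOn (M.actionsIn (M.maxEndComponent q) q) (actionsIn_maxEndComponent_nonempty h)
  else uniformOn Set.univ Set.univ_nonempty

/-- The transition matrix of the Markov chain that `M` follows under `M.stayStrategy`. -/
noncomputable def stayMatrix (M : MDP Q A) : Matrix Q Q ℝ :=
  Matrix.of fun s t => ∑ b, M.stayDist s b * M.δ s b t

theorem stayMatrix_mem_rowStochastic [DecidableEq Q] (M : MDP Q A) :
    M.stayMatrix ∈ Matrix.rowStochastic ℝ Q := by
  refine Matrix.mem_rowStochastic_iff_sum.2 ⟨fun s t => sum_nonneg fun b _ =>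
    mul_nonneg (stdSimplex.zero_le _ _) (stdSimplex.zero_le _ _), fun s => ?_⟩
  simp only [stayMatrix, Matrix.of_apply]
  rw [sum_comm]
  simp only [← mul_sum, stdSimplex.sum_eq_one, mul_one]

theorem stayMatrix_nonneg (s t : Q) : 0 ≤ M.stayMatrix s t := by
  classical
  exact Matrix.nonneg_of_mem_rowStochastic M.stayMatrix_mem_rowStochastic

theorem stayMatrix_pos_iff {s t : Q} :
    0 < M.stayMatrix s t ↔ ∃ b, 0 < M.stayDist s b ∧ 0 < M.δ s b t :=
  sum_mul_pos_iff (stdSimplex.zero_le _) fun b => stdSimplex.zero_le (M.δ s b) t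

theorem stayMatrix_pos_iff_edge {S : Set Q} (hS : M.IsMaximalEndComponent S) {s t : Q}
    (hs : s ∈ S) : 0 < M.stayMatrix s t ↔ M.Edge S s t := by
  have hsupp (b : A) : 0 < M.stayDist s b ↔ b ∈ M.actionsIn S s := by
    rw [stayDist, dif_pos (hS.1.subset_endUnion hs), uniformOn_pos_iff,
      maxEndComponent_eq hS hs]
  simp only [stayMatrix_pos_iff, hsupp, Edge]
  exact ⟨fun ⟨b, hb, ht⟩ => ⟨hs, hb ht, b, hb, ht⟩, fun ⟨_, _, h⟩ => h⟩

theorem isRecurrent_stayMatrix_of_mem_endUnion [DecidableEq Q] {q : Q} (hq : q ∈ M.endUnion) :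
    IsRecurrent M.stayMatrix q := by
  obtain ⟨S, hS, hqS⟩ := hq
  intro l t hl
  have hclosed {u : Q} (hqu : ReflTransGen (fun v w => 0 < M.stayMatrix v w) q u) : u ∈ S := by
    induction hqu with
    | refl => exact hqS
    | tail _ huv hu => exact ((stayMatrix_pos_iff_edge hS hu).1 huv).2.1
  have ht := hclosed ((exists_pow_apply_pos_iff_reflTransGen stayMatrix_nonneg).1 ⟨l, hl⟩)
  obtain ⟨u, -, hne⟩ := exists_ne_zero_of_sum_ne_zero
    ((Matrix.sum_row_of_mem_rowStochastic M.stayMatrix_mem_rowStochastic t).trans_ne one_ne_zero)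
  have htu := (stayMatrix_nonneg t u).lt_of_ne' hne
  obtain ⟨m, hm⟩ := (exists_pow_apply_pos_iff_reflTransGen stayMatrix_nonneg).2 <|
    ReflTransGen.mono (fun _ _ h => (stayMatrix_pos_iff_edge hS h.1).2 h) _ _
      (hS.1.2 u ((stayMatrix_pos_iff_edge hS ht).1 htu).2.1 q hqS)
  exact ⟨1 + m, by omega,
    (pow_add_apply_pos_iff stayMatrix_nonneg).2 ⟨u, by simpa using htu, hm⟩⟩

theorem dist_freezingStrategy_add [DecidableEq Q] {i : ℕ} (hi : 2 ^ Fintype.card Q ≤ i) (j : ℕ) :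
    M.dist d₀ M.freezingStrategy (i + j) =
      (M.dist d₀ M.freezingStrategy i : Q → ℝ) ᵥ* M.stayMatrix ^ j := by
  induction j with
  | zero => simp
  | succ j ih =>
    have hmemoryless (q a) : M.freezingStrategy (i + j) q a = M.stayDist (q (Fin.last _)) := by
      rw [freezingStrategy, if_neg (by omega)]
      rfl
    rw [pow_succ, ← Matrix.vecMul_vecMul, ← ih]
    ext t
    rw [← add_assoc, dist_succ]
    simp only [stateActionProb_of_memoryless hmemoryless, mul_assoc, ← mul_sum]
    rfl

theorem mem_supp_dist_freezingStrategy_add_iff [DecidableEq Q] {i : ℕ}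
    (hi : 2 ^ Fintype.card Q ≤ i) {j : ℕ} {t : Q} :
    t ∈ supp (M.dist d₀ M.freezingStrategy (i + j)) ↔
      ∃ s ∈ supp (M.dist d₀ M.freezingStrategy i), 0 < (M.stayMatrix ^ j) s t := by
  change 0 < M.dist d₀ M.freezingStrategy (i + j) t ↔ _
  rw [dist_freezingStrategy_add hi]
  exact sum_mul_pos_iff (stdSimplex.zero_le _)
    fun s => Matrix.pow_apply_nonneg stayMatrix_nonneg j s t

theorem mem_iterate_post_of_stayMatrix_pow_pos [DecidableEq Q] {S : Set Q} {i l : ℕ} {s t : Q}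
    (hs : s ∈ M.post^[i] S) (hl : 0 < (M.stayMatrix ^ l) s t) : t ∈ M.post^[i + l] S := by
  induction l generalizing t with
  | zero =>
    obtain rfl := pow_zero_apply_pos_iff.1 hl
    exact hs
  | succ l ih =>
    obtain ⟨u, hsu, hut⟩ := (pow_add_apply_pos_iff stayMatrix_nonneg).1 hl
    obtain ⟨b, -, hbt⟩ := stayMatrix_pos_iff.1 (by simpa using hut)
    rw [← add_assoc, iterate_succ_apply']
    exact ⟨u, ih hsu, b, hbt⟩

/-- A state of an end-component lies on a cycle of length `r` times the support period. Its last `r`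
steps start from a state that, by periodicity, is already occupied when the freezing begins. -/
theorem mem_supp_dist_freezingStrategy {q : Q} (hq : q ∈ M.endUnion) {i : ℕ}
    (hi : 2 ^ Fintype.card Q ≤ i) (hqi : q ∈ supp (M.dist d₀ (uniformStrategy Q A) i)) :
    q ∈ supp (M.dist d₀ M.freezingStrategy i) := by
  classical
  obtain ⟨r, rfl⟩ := Nat.exists_eq_add_of_le hi
  obtain ⟨l, hl⟩ := Nat.exists_eq_add_of_le (Nat.le_mul_of_pos_left r (supportPeriod_pos Q))
  have hloop : 0 < (M.stayMatrix ^ (l + r)) q q := by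
    rw [add_comm, ← hl]
    exact pow_mul_apply_self_pos stayMatrix_nonneg
      ((isRecurrent_stayMatrix_of_mem_endUnion hq).pow_supportPeriod_apply_pos stayMatrix_nonneg
        (m := 0) (by simp)) r
  obtain ⟨u, hqu, huq⟩ := (pow_add_apply_pos_iff stayMatrix_nonneg).1 hloop
  rw [supp_dist_uniformStrategy] at hqi
  have hu := mem_iterate_post_of_stayMatrix_pow_pos hqi hqu
  rw [add_assoc, ← hl, iterate_add_supportPeriod_mul _ _ le_rfl,
    ← supp_dist_freezingStrategy le_rfl] at hu
  exact (mem_supp_dist_freezingStrategy_add_iff le_rfl).2 ⟨u, hu, huq⟩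

theorem exists_le_dist_freezingStrategy {q : Q} (hq : q ∈ M.endUnion) {i : ℕ}
    (hi : 2 ^ Fintype.card Q ≤ i) (hqi : q ∈ supp (M.dist d₀ M.freezingStrategy i)) :
    ∃ c > 0, ∀ m, c ≤ M.dist d₀ M.freezingStrategy (i + supportPeriod Q * m) q := by
  classical
  obtain ⟨c, hc, hle⟩ := (isRecurrent_stayMatrix_of_mem_endUnion hq).exists_le_pow_supportPeriod_mul
    M.stayMatrix_mem_rowStochastic
  refine ⟨M.dist d₀ M.freezingStrategy i q * c, mul_pos hqi hc, fun m => ?_⟩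
  rw [dist_freezingStrategy_add hi]
  calc M.dist d₀ M.freezingStrategy i q * c
      ≤ M.dist d₀ M.freezingStrategy i q * (M.stayMatrix ^ (supportPeriod Q * m)) q q :=
        mul_le_mul_of_nonneg_left (hle m) (le_of_lt hqi)
    _ ≤ ∑ s, M.dist d₀ M.freezingStrategy i s * (M.stayMatrix ^ (supportPeriod Q * m)) s q :=
        single_le_sum (f := fun s => M.dist d₀ M.freezingStrategy i s *
            (M.stayMatrix ^ (supportPeriod Q * m)) s q)
          (fun s _ => mul_nonneg (stdSimplex.zero_le _ _)
            (Matrix.pow_apply_nonneg stayMatrix_nonneg _ s q)) (mem_univ q)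

end Freezing

section Synchronization

variable {Q A : Type*} [Fintype Q] {d : ℕ → stdSimplex ℝ Q} {T : Set Q}

theorem boundedlyAlways_iff :
    BoundedlyAlways d T ↔ PositivelyAlways d T ∧ BoundedlyStrongly d T := by
  refine ⟨fun ⟨ε, hε, h⟩ => ⟨fun i => hε.trans (h i), ε, hε, 0, fun i _ => h i⟩, ?_⟩
  rintro ⟨hpos, ε, hε, N, hN⟩
  obtain ⟨η, hη, hlt⟩ := exists_pos_forall_lt_of_pos fun i : Fin N => mass (d i) T
  refine ⟨min ε η, lt_min hε hη, fun i => ?_⟩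
  rcases lt_or_ge i N with hi | hi
  · exact (min_le_right ε η).trans_lt (hlt ⟨i, hi⟩ (hpos i))
  · exact (min_le_left ε η).trans_lt (hN i hi)

variable [Fintype A] [Nonempty A] {M : MDP Q A} {d₀ : stdSimplex ℝ Q} {σ : Strategy Q A}

theorem condition1_of_positivelyAlways (h : PositivelyAlways (M.dist d₀ σ) T) :
    M.Condition1 d₀ T := fun i => by
  obtain ⟨q, hqT, hq⟩ := mass_pos_iff.1 (h i)
  exact mass_pos_iff.2
    ⟨q, hqT, by simpa only [supp_dist_uniformStrategy] using supp_dist_subset_iterate_post i hq⟩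

theorem condition2_of_boundedlyStrongly (h : BoundedlyStrongly (M.dist d₀ σ) T) :
    M.Condition2 d₀ T := fun i hi => by
  obtain ⟨ε, hε, N, hN⟩ := h
  obtain ⟨m, hm⟩ := exists_lt_of_tendsto_cesaro_zero (fun _ => mass_nonneg _)
    (tendsto_cesaro_mass_compl_endUnion M d₀ σ) (i + supportPeriod Q * N) (supportPeriod_pos Q) hε
  rw [add_assoc, ← mul_add] at hm
  have hlate : N ≤ i + supportPeriod Q * (N + m) :=
    (Nat.le_add_right N m).trans <|
      (Nat.le_mul_of_pos_left _ (supportPeriod_pos Q)).trans (Nat.le_add_left _ i)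
  have hmass : 0 < mass (M.dist d₀ σ (i + supportPeriod Q * (N + m))) (M.endUnion ∩ T) :=
    pos_of_lt_add_left (hm.trans ((hN _ hlate).trans_le (mass_le_mass_inter_add_mass_compl _ _)))
  obtain ⟨q, hqT, hq⟩ := mass_pos_iff.1 hmass
  refine mass_pos_iff.2 ⟨q, hqT, ?_⟩
  rw [supp_dist_uniformStrategy, ← iterate_add_supportPeriod_mul _ _ hi (N + m)]
  exact supp_dist_subset_iterate_post _ hq

theorem boundedlyStrongly_freezingStrategy (h : M.Condition2 d₀ T) :
    BoundedlyStrongly (M.dist d₀ M.freezingStrategy) T := by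
  obtain ⟨ε, hε, hlt⟩ := exists_pos_forall_lt_of_arithmetic_progressions
    (f := fun i => mass (M.dist d₀ M.freezingStrategy (2 ^ Fintype.card Q + i)) T)
    (supportPeriod_pos Q) fun r => by
      have hr : 2 ^ Fintype.card Q ≤ 2 ^ Fintype.card Q + r := Nat.le_add_right _ r
      obtain ⟨q, ⟨hqE, hqT⟩, hq⟩ := mass_pos_iff.1 (h _ hr)
      obtain ⟨c, hc, hle⟩ :=
        exists_le_dist_freezingStrategy hqE hr (mem_supp_dist_freezingStrategy hqE hr hq)
      exact ⟨c, hc, fun m => (hle m).trans (by rw [add_assoc]; exact apply_le_mass hqT)⟩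
  refine ⟨ε, hε, 2 ^ Fintype.card Q, fun i hi => ?_⟩
  obtain ⟨j, rfl⟩ := Nat.exists_eq_add_of_le hi
  exact hlt j

theorem positivelyAlways_freezingStrategy (h₁ : M.Condition1 d₀ T) (h₂ : M.Condition2 d₀ T) :
    PositivelyAlways (M.dist d₀ M.freezingStrategy) T := fun i => by
  rcases le_total i (2 ^ Fintype.card Q) with hi | hi
  · obtain ⟨q, hqT, hq⟩ := mass_pos_iff.1 (h₁ i)
    rw [supp_dist_uniformStrategy, ← supp_dist_freezingStrategy hi] at hq
    exact mass_pos_iff.2 ⟨q, hqT, hq⟩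
  · obtain ⟨q, ⟨hqE, hqT⟩, hq⟩ := mass_pos_iff.1 (h₂ i hi)
    exact mass_pos_iff.2 ⟨q, hqT, mem_supp_dist_freezingStrategy hqE hi hq⟩

end Synchronization

end MDP

theorem mainTheorem4 {Q A : Type*} [Fintype Q] [Fintype A] [Nonempty A] (M : MDP Q A)
    (d₀ : stdSimplex ℝ Q) (T : Set Q) :
    (d₀ ∈ M.winPositiveAlways T ↔ M.Condition1 d₀ T) ∧
    (d₀ ∈ M.winBoundedStrongly T ↔ M.Condition2 d₀ T) ∧
    (d₀ ∈ M.winBoundedAlways T ↔ M.Condition1 d₀ T ∧ M.Condition2 d₀ T) ∧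
    (M.Condition2 d₀ T → MDP.BoundedlyStrongly (M.dist d₀ M.freezingStrategy) T) ∧
    (M.Condition1 d₀ T → M.Condition2 d₀ T →
      MDP.BoundedlyAlways (M.dist d₀ M.freezingStrategy) T) := by
  have hstrong (h₂ : M.Condition2 d₀ T) := MDP.boundedlyStrongly_freezingStrategy h₂
  have hbounded (h₁ : M.Condition1 d₀ T) (h₂ : M.Condition2 d₀ T) :
      MDP.BoundedlyAlways (M.dist d₀ M.freezingStrategy) T :=
    MDP.boundedlyAlways_iff.2 ⟨MDP.positivelyAlways_freezingStrategy h₁ h₂, hstrong h₂⟩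
  refine ⟨⟨fun ⟨_, h⟩ => MDP.condition1_of_positivelyAlways h, fun h₁ => ⟨_, h₁⟩⟩,
    ⟨fun ⟨_, h⟩ => MDP.condition2_of_boundedlyStrongly h, fun h₂ => ⟨_, hstrong h₂⟩⟩,
    ⟨fun ⟨_, h⟩ => ?_, fun ⟨h₁, h₂⟩ => ⟨_, hbounded h₁ h₂⟩⟩, hstrong, hbounded⟩
  exact (MDP.boundedlyAlways_iff.1 h).imp
    MDP.condition1_of_positivelyAlways MDP.condition2_of_boundedlyStrongly
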